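/- Let $g:\mathbb{C}\to\mathbb{C}$ be a non-constant entire function with an attracting fixed point at $0$, i.e. $g(0)=0$ and $|g'(0)|<1$. Let $f(z)=z+1+e^{-z}$. Then there exists a transcendental entire function $h:\mathbb{C}\to\mathbb{C}$ such that the skew product $$F_h:\mathbb{C}^2\to\mathbb{C}^2,\qquad F_h(z,w)=\bigl(f(z)+w\,h(z),\,g(w)\bigr),$$ has a Baker domain on the invariant fiber $\{w=0\}$ that does not bulge. More precisely, $f=F_h(\cdot,0)$ has a forward invariant Baker domain $B$ containing the half plane $\{\operatorname{Re} z>0\}$, and there is no Fatou component $\Omega$ of $F_h$ with $B\times\{0\}\subset\Omega$. Moreover, $h$ can be chosen so that there are a point $x_0\in B$ and non-zero complex numbers $w_n$ ($n\ge 0$) with $w_n\to 0$ such that, for all $n\ge 0$, the first coordinate of $F_h^{\,n+1}(x_0,w_n)$ has modulus at most $3$. Here a Baker domain of a transcendental entire function is a periodic Fatou component on which all orbits tend to infinity. The Fatou set of $f$ (resp. $F_h$) is the set of points having an open neighbourhood on which the iterates are normal as maps to the Riemann sphere (resp. to $\mathbb{P}^2\supset\mathbb{C}^2$, that is, every sequence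 of iterates has a subsequence converging, uniformly on compact subsets, to a holomorphic map into $\mathbb{P}^2$), and a Fatou component is a connected component of the Fatou set. -/

import Mathlib

open Filter Topology

/-- The complex projective plane. -/
def CP2 : Type := Projectivization ℂ (Fin 3 → ℂ)

/-- The point `[v₀ : v₁ : v₂]` of the projective plane. -/
noncomputable def CP2.mk (v : {v : Fin 3 → ℂ // v ≠ 0}) : CP2 := Projectivization.mk' ℂ v

/-- The quotient topology from `ℂ³ \ {0}`. -/
noncomputable instance CP2.instTopologicalSpace : TopologicalSpace CP2 :=
  TopologicalSpace.coinduced CP2.mk inferInstance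

/-- The compactification `ℂ² → ℙ²`, `(z, w) ↦ [z : w : 1]`, adding a line at infinity. -/
noncomputable def toCP2 (p : ℂ × ℂ) : CP2 :=
  CP2.mk ⟨![p.1, p.2, 1], fun h => one_ne_zero (congrFun h 2)⟩

/-- A map from an open subset `U` of `ℂ²` to `ℙ²` is holomorphic if it locally has the form
`p ↦ [φ₀ p : φ₁ p : φ₂ p]` with `φ` holomorphic and without zeros. -/
def IsHolomorphicToCP2 (U : Set (ℂ × ℂ)) (G : U → CP2) : Prop :=
  ∀ x ∈ U, ∃ V : Set (ℂ × ℂ), IsOpen V ∧ x ∈ V ∧ ∃ φ : ℂ × ℂ → Fin 3 → ℂ,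
    DifferentiableOn ℂ φ V ∧
      ∀ (y : U), (y : ℂ × ℂ) ∈ V → ∃ hy : φ y ≠ 0, G y = CP2.mk ⟨φ y, hy⟩

/-- A family `𝓕` of maps `X → Y` is normal on `U`, with limit functions in the class `L`, if every
sequence in `𝓕` has a subsequence that converges uniformly on compact subsets of `U`
(i.e. in the compact-open topology of `C(U, Y)`) to a continuous map in `L`. -/
def IsNormalOn {X Y : Type*} [TopologicalSpace X] [TopologicalSpace Y]
    (𝓕 : Set (X → Y)) (U : Set X) (L : (U → Y) → Prop) : Prop :=
  ∀ φ : ℕ → X → Y, (∀ n, φ n ∈ 𝓕) →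
    ∃ s : ℕ → ℕ, StrictMono s ∧ ∃ (Φ : ℕ → C(U, Y)) (G : C(U, Y)),
      (∀ k (x : U), Φ k x = φ (s k) x) ∧ L G ∧ Tendsto Φ atTop (𝓝 G)

/-- The Fatou set of an entire function: the points with a neighbourhood on which the iterates are
normal as maps to the Riemann sphere. (Limits of holomorphic maps to the sphere are automatically
holomorphic, so there is no further condition on the limit functions.) -/
def fatouSet (f : ℂ → ℂ) : Set ℂ :=
  {z | ∃ U : Set ℂ, IsOpen U ∧ z ∈ U ∧
    IsNormalOn (Set.range fun (n : ℕ) (x : ℂ) => ((f^[n] x : ℂ) : OnePoint ℂ)) U fun _ => True}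

/-- The Fatou set of a holomorphic self-map of `ℂ²`: the points with a neighbourhood on which the
iterates are normal as maps to `ℙ²`, with holomorphic limit functions. -/
def fatouSet₂ (F : ℂ × ℂ → ℂ × ℂ) : Set (ℂ × ℂ) :=
  {p | ∃ U : Set (ℂ × ℂ), IsOpen U ∧ p ∈ U ∧
    IsNormalOn (Set.range fun (n : ℕ) (x : ℂ × ℂ) => toCP2 (F^[n] x)) U (IsHolomorphicToCP2 U)}

/-- A Fatou component is a connected component of the Fatou set. -/
def IsFatouComponent (f : ℂ → ℂ) (U : Set ℂ) : Prop :=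
  ∃ z ∈ fatouSet f, U = connectedComponentIn (fatouSet f) z

/-- A Fatou component is a connected component of the Fatou set. -/
def IsFatouComponent₂ (F : ℂ × ℂ → ℂ × ℂ) (Ω : Set (ℂ × ℂ)) : Prop :=
  ∃ p ∈ fatouSet₂ F, Ω = connectedComponentIn (fatouSet₂ F) p

/-- An entire function that is not a polynomial. -/
def IsTranscendentalEntire (f : ℂ → ℂ) : Prop :=
  Differentiable ℂ f ∧ ¬ ∃ P : Polynomial ℂ, ∀ z, f z = P.eval z

/-- A Baker domain of a transcendental entire function: a periodic Fatou component on which orbits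
tend to infinity. -/
structure IsBakerDomain (f : ℂ → ℂ) (B : Set ℂ) : Prop where
  transcendental : IsTranscendentalEntire f
  component : IsFatouComponent f B
  periodic : ∃ p : ℕ, 0 < p ∧ Set.MapsTo f^[p] B B
  escaping : ∀ z ∈ B, Tendsto (fun n : ℕ => f^[n] z) atTop (Bornology.cobounded ℂ)

/-- The map `f₀ = f(·, 0)` that a skew product `F(z, w) = (f(z, w), g(w))` with `g(0) = 0` induces
on the invariant fiber `{w = 0}`. -/
def fiberMap (F : ℂ × ℂ → ℂ × ℂ) (z : ℂ) : ℂ := (F (z, 0)).1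

/-- A subset `U` of the fiber `{w = 0}` (a Fatou component of `fiberMap F`) bulges if some
Fatou component `Ω` of `F` satisfies `U ⊆ Ω ∩ {w = 0}`. -/
def Bulges (F : ℂ × ℂ → ℂ × ℂ) (U : Set ℂ) : Prop :=
  ∃ Ω : Set (ℂ × ℂ), IsFatouComponent₂ F Ω ∧ ∀ z ∈ U, (z, (0 : ℂ)) ∈ Ω

/-- The skew product `F_h(z, w) = (z + 1 + e^{-z} + w h(z), g(w))`. -/
noncomputable def skewProduct (g h : ℂ → ℂ) (p : ℂ × ℂ) : ℂ × ℂ :=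
  (p.1 + 1 + Complex.exp (-p.1) + p.2 * h p.1, g p.2)

/-!
# A Baker domain of a skew product that does not bulge

On the half plane `Re z > a > 0`, Fatou's function `f(z) = z + 1 + e^{-z}` moves points to the right
by a definite amount, so its iterates escape to infinity uniformly there. The set of points with a
neighbourhood of uniform escape is open and contained in the Fatou set; it is also relatively
closed in the Fatou set, because a limit function that is `∞` on an open set is `∞` on every
connected set that meets it (`eq_infty_of_tendsto`, the identity theorem for the reciprocals of the
iterates). So the Fatou component of `2` consists of such points
(`connectedComponentIn_fatouSet_subset`); it contains the right half plane, and it is forward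
invariant since `f` is an open map.

For the failure of bulging it suffices that points `(2, w_n)` with `w_n → 0` return to `z = 0` at
time `n + 1`, while `(2, 0)` escapes to `[1 : 0 : 0]`: then no subsequence of the iterates converges
locally uniformly near `(2, 0)` (`notMem_fatouSet₂_of_tendsto`).

The function `h` is a sum of monomials `(z / ρ_n) ^ N_n` with `ρ_n` slightly smaller than the `n`-th
point `x_n` of the orbit of `2`. Given the earlier monomials, choose `ε_n` so small that for
`|w| ≤ ε_n` the orbit of `(2, w)` stays close to `x_0, …, x_n`. The `n`-th iterate of `g` has no zero
on the circle `|w| = ε_n`, so if `N_n` is large, the perturbation `g^n(w) h(z)` at the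
`n`-th step is large on this circle. The first coordinate at time `n + 1`, an entire function of
`w`, is then larger on the circle than its value `x_{n+1}` at `w = 0`, so it has a zero `w_n` in
the disc (`exists_zero_of_norm_lt_norm_sphere`, `exists_next_summand`). As each monomial is tiny on
the discs that the earlier ones are concerned with, all choices can be made one after another
(`exists_transcendental_forall_exists_zero`).
-/

/-! ### Uniformly escaping points of an entire function -/

theorem Nat.exists_subseq_const_or_tendsto (m : ℕ → ℕ) :
    ∃ s : ℕ → ℕ, StrictMono s ∧ ((∃ c, ∀ k, m (s k) = c) ∨ Tendsto (m ∘ s) atTop atTop) := by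
  by_cases h : Tendsto m atTop atTop
  · exact ⟨id, strictMono_id, Or.inr h⟩
  · have : ∃ c, ∃ᶠ n in atTop, m n = c := by
      by_contra! hc
      refine h (tendsto_atTop.2 fun b => ?_)
      have hb : ∀ᶠ n in atTop, ∀ c ∈ Finset.range b, m n ≠ c :=
        (eventually_all_finset _).2 fun c _ => by simpa using hc c
      filter_upwards [hb] with n hn
      by_contra hlt
      exact hn (m n) (Finset.mem_range.2 (not_le.1 hlt)) rfl
    obtain ⟨c, hc⟩ := this
    obtain ⟨s, hs, hsc⟩ := extraction_of_frequently_atTop hc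
    exact ⟨s, hs, Or.inl ⟨c, hsc⟩⟩

theorem OnePoint.exists_forall_coe_mem_of_mem_nhds_infty {V : Set (OnePoint ℂ)}
    (hV : V ∈ 𝓝 (OnePoint.infty : OnePoint ℂ)) :
    ∃ R : ℝ, ∀ z : ℂ, R < ‖z‖ → (z : OnePoint ℂ) ∈ V := by
  have h := (OnePoint.tendsto_coe_infty (X := ℂ)).eventually hV
  rw [coclosedCompact_eq_cocompact, ← Metric.cobounded_eq_cocompact] at h
  obtain ⟨R, -, hR⟩ := (Metric.hasBasis_cobounded_compl_closedBall (0 : ℂ)).eventually_iff.1 h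
  exact ⟨R, fun z hz => hR (by simpa using hz)⟩

theorem OnePoint.isOpen_compl_image_closedBall (R : ℝ) :
    IsOpen (((↑) '' Metric.closedBall (0 : ℂ) R)ᶜ : Set (OnePoint ℂ)) :=
  OnePoint.isOpen_compl_image_coe.2 ⟨Metric.isClosed_closedBall, isCompact_closedBall _ _⟩

/-- The points with a neighbourhood on which the iterates of `f` tend to infinity uniformly. -/
def uniformlyEscapingSet (f : ℂ → ℂ) : Set ℂ :=
  {z | ∃ U : Set ℂ, IsOpen U ∧ z ∈ U ∧ ∀ R : ℝ, ∀ᶠ n in atTop, ∀ y ∈ U, R < ‖f^[n] y‖}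

theorem isOpen_uniformlyEscapingSet (f : ℂ → ℂ) : IsOpen (uniformlyEscapingSet f) :=
  isOpen_iff_forall_mem_open.2 fun _ ⟨U, hU, hz, h⟩ => ⟨U, fun _ hy => ⟨U, hU, hy, h⟩, hU, hz⟩

theorem tendsto_cobounded_of_mem_uniformlyEscapingSet {f : ℂ → ℂ} {z : ℂ}
    (hz : z ∈ uniformlyEscapingSet f) :
    Tendsto (fun n : ℕ => f^[n] z) atTop (Bornology.cobounded ℂ) := by
  obtain ⟨U, -, hzU, h⟩ := hz
  refine tendsto_norm_atTop_iff_cobounded.1 (tendsto_atTop.2 fun R => ?_)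
  filter_upwards [h R] with n hn using (hn z hzU).le

theorem uniformlyEscapingSet_subset_fatouSet {f : ℂ → ℂ} (hf : Continuous f) :
    uniformlyEscapingSet f ⊆ fatouSet f := by
  rintro z ⟨U, hU, hzU, hesc⟩
  refine ⟨U, hU, hzU, fun φ hφ => ?_⟩
  choose m hm using hφ
  obtain ⟨s, hs, hcase⟩ := Nat.exists_subseq_const_or_tendsto m
  have hcont : ∀ n, Continuous fun x : U => ((f^[n] x : ℂ) : OnePoint ℂ) := fun n =>
    OnePoint.continuous_coe.comp ((hf.iterate n).comp continuous_subtype_val)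
  refine ⟨s, hs, fun k => ⟨_, hcont (m (s k))⟩, ?_⟩
  rcases hcase with ⟨c, hc⟩ | htend
  · refine ⟨⟨_, hcont c⟩, fun k x => by rw [← hm]; rfl, trivial, ?_⟩
    simp only [hc]
    exact tendsto_const_nhds
  · refine ⟨ContinuousMap.const _ OnePoint.infty, fun k x => by rw [← hm]; rfl, trivial, ?_⟩
    rw [ContinuousMap.tendsto_nhds_compactOpen]
    intro K _ V hV hKV
    rcases K.eq_empty_or_nonempty with rfl | ⟨x, hx⟩
    · exact Eventually.of_forall fun _ => Set.mapsTo_empty _ _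
    · obtain ⟨R, hR⟩ := OnePoint.exists_forall_coe_mem_of_mem_nhds_infty (hV.mem_nhds (hKV hx))
      filter_upwards [htend.eventually (hesc R)] with k hk y _ using hR _ (hk y y.2)

/-- If `f` is open, then `f '' U` is a neighbourhood of `f z` for every neighbourhood `U` of `z`, and
the iterates on it are those on `U`, shifted by one. -/
theorem mapsTo_uniformlyEscapingSet {f : ℂ → ℂ} (hf : IsOpenMap f) :
    Set.MapsTo f (uniformlyEscapingSet f) (uniformlyEscapingSet f) := by
  rintro z ⟨U, hU, hzU, hesc⟩
  refine ⟨f '' U, hf U hU, Set.mem_image_of_mem f hzU, fun R => ?_⟩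
  filter_upwards [(tendsto_add_atTop_nat 1).eventually (hesc R)] with n hn
  rintro _ ⟨y, hy, rfl⟩
  exact hn y hy

theorem conj_div_max_eq_inv {z : ℂ} (hz : 1 ≤ ‖z‖) :
    (starRingEnd ℂ z) / ((max 1 (‖z‖ ^ 2) : ℝ) : ℂ) = z⁻¹ := by
  rw [max_eq_right (one_le_pow₀ hz), Complex.inv_def, Complex.normSq_eq_norm_sq, div_eq_mul_inv,
    Complex.ofReal_inv]

/-- A continuous function on the Riemann sphere which is `z ↦ 1 / z` for `|z| ≥ 1`, including
`∞ ↦ 0`: the chart at infinity, cut off near the origin. -/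
noncomputable def chartAtInfty : C(OnePoint ℂ, ℂ) :=
  OnePoint.continuousMapMk
    ⟨fun z => (starRingEnd ℂ z) / ((max 1 (‖z‖ ^ 2) : ℝ) : ℂ), by
      refine Continuous.div (by fun_prop) (by fun_prop) fun z => ?_
      exact_mod_cast (lt_of_lt_of_le one_pos (le_max_left _ _)).ne'⟩ 0 (by
    rw [coclosedCompact_eq_cocompact, ← Metric.cobounded_eq_cocompact]
    refine tendsto_inv₀_cobounded.congr' ?_
    filter_upwards [tendsto_norm_cobounded_atTop.eventually_ge_atTop (1 : ℝ)] with z hz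
    exact (conj_div_max_eq_inv hz).symm)

theorem chartAtInfty_coe {z : ℂ} (hz : 1 ≤ ‖z‖) : chartAtInfty (z : OnePoint ℂ) = z⁻¹ :=
  conj_div_max_eq_inv hz

theorem chartAtInfty_infty : chartAtInfty OnePoint.infty = 0 := rfl

/-- A sphere-valued locally uniform limit of entire functions that equals `∞` on an open set meeting
the connected set `D` equals `∞` on all of `D`: near a boundary point of the interior of the set
where it is `∞`, the reciprocals are holomorphic, and the identity theorem applies to their
limit. -/
theorem eq_infty_of_tendsto {F : ℕ → ℂ → ℂ} (hF : ∀ k, Differentiable ℂ (F k)) {U : Set ℂ}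
    (hU : IsOpen U) {Φ : ℕ → C(U, OnePoint ℂ)} {G : C(U, OnePoint ℂ)}
    (hΦ : ∀ k (x : U), Φ k x = (F k x : OnePoint ℂ)) (hlim : Tendsto Φ atTop (𝓝 G))
    {D : Set ℂ} (hD : IsPreconnected D) (hDU : D ⊆ U) {W : Set ℂ} (hW : IsOpen W)
    (hWD : (D ∩ W).Nonempty) (hWU : W ⊆ U)
    (hGW : ∀ x : U, (x : ℂ) ∈ W → G x = OnePoint.infty) :
    ∀ x : U, (x : ℂ) ∈ D → G x = OnePoint.infty := by
  have : LocallyCompactSpace U := hU.locallyCompactSpace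
  let A : Set ℂ := interior {y | ∃ hy : y ∈ U, G ⟨y, hy⟩ = OnePoint.infty}
  have hWA : W ⊆ A := interior_maximal (fun y hy => ⟨hWU hy, hGW ⟨y, hWU hy⟩ hy⟩) hW
  suffices h : D ⊆ A by
    intro x hx
    obtain ⟨_, h'⟩ := interior_subset (h hx)
    exact h'
  refine hD.subset_of_closure_inter_subset isOpen_interior
    (hWD.mono (Set.inter_subset_inter_right _ hWA)) ?_
  rintro y ⟨hyA, hyD⟩
  have hyU := hDU hyD
  have hGy : G ⟨y, hyU⟩ = OnePoint.infty := by
    have hcl : IsClosed {x : U | G x = OnePoint.infty} :=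
      isClosed_eq G.continuous continuous_const
    have hy' : (⟨y, hyU⟩ : U) ∈ closure {x : U | G x = OnePoint.infty} := by
      rw [closure_subtype]
      refine closure_mono ?_ hyA
      intro t ht
      obtain ⟨htU, ht'⟩ := interior_subset ht
      exact ⟨⟨t, htU⟩, ht', rfl⟩
    rwa [hcl.closure_eq] at hy'
  -- `O` is the set where `chartAtInfty` is the reciprocal. The limit maps a small ball around `y`
  -- into `O`, so that there the functions `F k` are eventually at least `1` in modulus.
  let O : Set (OnePoint ℂ) := ((↑) '' Metric.closedBall (0 : ℂ) 1)ᶜ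
  have hO : IsOpen O := OnePoint.isOpen_compl_image_closedBall 1
  have hO1 : ∀ z : ℂ, (z : OnePoint ℂ) ∈ O → 1 ≤ ‖z‖ := by
    intro z hz
    by_contra hlt
    exact hz ⟨z, by simpa using (not_le.1 hlt).le, rfl⟩
  have hpre : ∀ᶠ x in 𝓝 y, ∃ hx : x ∈ U, G ⟨x, hx⟩ ∈ O := by
    have h1 : ∀ᶠ x in 𝓝 (⟨y, hyU⟩ : U), G x ∈ O :=
      G.continuous.continuousAt.eventually (hO.mem_nhds (by rw [hGy]; simp [O]))
    rw [nhds_subtype_eq_comap, eventually_comap] at h1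
    filter_upwards [h1, hU.mem_nhds hyU] with x hx hxU using ⟨hxU, hx ⟨x, hxU⟩ rfl⟩
  obtain ⟨r, hr, hball⟩ := Metric.nhds_basis_closedBall.eventually_iff.1 hpre
  have hKU : Metric.closedBall y r ⊆ U := fun x hx => (hball hx).1
  let K : Set U := Subtype.val ⁻¹' Metric.closedBall y r
  have hK : IsCompact K := by
    rw [Subtype.isCompact_iff, Subtype.image_preimage_coe, Set.inter_eq_right.2 hKU]
    exact isCompact_closedBall _ _
  have hlarge : ∀ᶠ k in atTop, ∀ x ∈ Metric.closedBall y r, 1 ≤ ‖F k x‖ := by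
    have hGK : Set.MapsTo G K O := fun x hx => (hball hx).2
    filter_upwards [ContinuousMap.tendsto_nhds_compactOpen.1 hlim K hK O hO hGK] with k hk x hx
    have := hk (x := ⟨x, hKU hx⟩) hx
    rw [hΦ] at this
    exact hO1 _ this
  -- `ℓ` is the limit in the chart at infinity, with junk values outside `U`.
  obtain ⟨ℓ, hℓ⟩ : ∃ ℓ : ℂ → ℂ, ∀ x : U, ℓ x = chartAtInfty (G x) :=
    ⟨Function.extend Subtype.val (chartAtInfty ∘ G) 0, Subtype.val_injective.extend_apply _ _⟩
  have hloc : TendstoUniformlyOn (fun k x => (F k x)⁻¹) ℓ atTop (Metric.ball y r) := by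
    have h1 := (chartAtInfty.continuous_postcomp (X := U)).continuousAt.tendsto.comp hlim
    have h2 := ContinuousMap.tendsto_iff_forall_isCompact_tendstoUniformlyOn.1 h1 K hK
    rw [Metric.tendstoUniformlyOn_iff] at h2 ⊢
    intro ε hε
    filter_upwards [h2 ε hε, hlarge] with k hk hk1 x hx
    have hx' := Metric.ball_subset_closedBall hx
    have := hk ⟨x, hKU hx'⟩ hx'
    simp only [Function.comp_apply, ContinuousMap.comp_apply, hΦ] at this
    rwa [chartAtInfty_coe (hk1 x hx'), ← hℓ] at this
  have hdiff : DifferentiableOn ℂ ℓ (Metric.ball y r) := by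
    refine hloc.tendstoLocallyUniformlyOn.differentiableOn ?_ Metric.isOpen_ball
    filter_upwards [hlarge] with k hk
    exact (hF k).differentiableOn.inv fun x hx => norm_pos_iff.1
      (lt_of_lt_of_le one_pos (hk x (Metric.ball_subset_closedBall hx)))
  obtain ⟨t, htb, htA⟩ := mem_closure_iff.1 hyA _ Metric.isOpen_ball (Metric.mem_ball_self hr)
  have hzero : Set.EqOn ℓ 0 (Metric.ball y r) := by
    refine (hdiff.analyticOnNhd Metric.isOpen_ball).eqOn_zero_of_preconnected_of_eventuallyEq_zero
      (convex_ball y r).isPreconnected htb ?_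
    filter_upwards [isOpen_interior.mem_nhds htA] with x hx
    obtain ⟨hxU, hx'⟩ := interior_subset hx
    rw [hℓ ⟨x, hxU⟩, hx', chartAtInfty_infty, Pi.zero_apply]
  refine mem_interior.2 ⟨Metric.ball y r, fun x hx => ?_, Metric.isOpen_ball,
    Metric.mem_ball_self hr⟩
  have hxU := hKU (Metric.ball_subset_closedBall hx)
  refine ⟨hxU, ?_⟩
  have h0 : chartAtInfty (G ⟨x, hxU⟩) = 0 := (hℓ ⟨x, hxU⟩).symm.trans (hzero hx)
  have hxO := (hball (Metric.ball_subset_closedBall hx)).2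
  induction hg : G ⟨x, hxU⟩ using OnePoint.rec with
  | infty => rfl
  | coe z =>
    rw [hg] at h0 hxO
    rw [chartAtInfty_coe (hO1 z hxO), inv_eq_zero] at h0
    have := hO1 z hxO
    rw [h0, norm_zero] at this
    exact absurd this (by norm_num)

/-- The uniformly escaping set is relatively closed in the Fatou set: if the iterates did not escape
uniformly near a limit point `z`, then infinitely many of them would take a value of modulus at most
`R` near `z`, but a subsequence of these has a limit function that is `∞` on a non-empty open set,
hence on a whole ball around `z`. -/
theorem closure_uniformlyEscapingSet_inter_fatouSet_subset {f : ℂ → ℂ} (hf : Differentiable ℂ f) :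
    closure (uniformlyEscapingSet f) ∩ fatouSet f ⊆ uniformlyEscapingSet f := by
  rintro z ⟨hz, U, hU, hzU, hnorm⟩
  obtain ⟨r, hr, hrU⟩ := Metric.isOpen_iff.1 hU z hzU
  refine ⟨Metric.ball z (r / 2), Metric.isOpen_ball, Metric.mem_ball_self (by positivity), ?_⟩
  by_contra! hcon
  obtain ⟨R, hR⟩ := hcon
  obtain ⟨m, hm, hmR⟩ := extraction_of_frequently_atTop hR
  obtain ⟨s, hs, Φ, G, hΦ, -, hlim⟩ :=
    hnorm (fun n x => ((f^[m n] x : ℂ) : OnePoint ℂ)) fun n => ⟨m n, rfl⟩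
  obtain ⟨t, htb, htS⟩ := mem_closure_iff.1 hz _ Metric.isOpen_ball (Metric.mem_ball_self hr)
  have hG : ∀ x : U, (x : ℂ) ∈ Metric.ball z r → G x = OnePoint.infty := by
    refine eq_infty_of_tendsto (F := fun k => f^[m (s k)]) (fun k => hf.iterate _) hU hΦ hlim
      (convex_ball z r).isPreconnected hrU
      (W := Metric.ball z r ∩ uniformlyEscapingSet f)
      (Metric.isOpen_ball.inter (isOpen_uniformlyEscapingSet f)) ⟨t, htb, htb, htS⟩
      (fun x hx => hrU hx.1) ?_
    rintro x ⟨-, hx⟩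
    have h1 : Tendsto (fun k => Φ k x) atTop (𝓝 (G x)) :=
      ((continuous_eval_const x).tendsto G).comp hlim
    have h2 : Tendsto (fun k => Φ k x) atTop (𝓝 OnePoint.infty) := by
      simp only [hΦ]
      have h3 := (tendsto_cobounded_of_mem_uniformlyEscapingSet hx).comp
        (hm.comp hs).tendsto_atTop
      rw [Metric.cobounded_eq_cocompact, ← coclosedCompact_eq_cocompact] at h3
      exact OnePoint.tendsto_coe_infty.comp h3
    exact tendsto_nhds_unique h1 h2
  have hsub : Metric.closedBall z (r / 2) ⊆ Metric.ball z r :=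
    Metric.closedBall_subset_ball (by linarith)
  have hK : IsCompact (Subtype.val ⁻¹' Metric.closedBall z (r / 2) : Set U) := by
    rw [Subtype.isCompact_iff, Subtype.image_preimage_coe,
      Set.inter_eq_right.2 (hsub.trans hrU)]
    exact isCompact_closedBall _ _
  have hGK : Set.MapsTo G (Subtype.val ⁻¹' Metric.closedBall z (r / 2))
      (((↑) '' Metric.closedBall (0 : ℂ) R)ᶜ : Set (OnePoint ℂ)) := by
    intro x hx
    rw [hG x (hsub hx)]
    simp
  obtain ⟨k, hk⟩ := (ContinuousMap.tendsto_nhds_compactOpen.1 hlim _ hK _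
    (OnePoint.isOpen_compl_image_closedBall R) hGK).exists
  obtain ⟨y, hy, hyR⟩ := hmR (s k)
  have hy' := Metric.ball_subset_closedBall hy
  have := hk (x := ⟨y, hrU (hsub hy')⟩) hy'
  rw [hΦ] at this
  exact this ⟨_, by simpa using hyR, rfl⟩

/-- A Fatou component that contains a single uniformly escaping point consists of such points, since
these form a subset that is open and relatively closed in the Fatou set. -/
theorem connectedComponentIn_fatouSet_subset {f : ℂ → ℂ} (hf : Differentiable ℂ f) {z : ℂ}
    (hz : z ∈ uniformlyEscapingSet f) :
    connectedComponentIn (fatouSet f) z ⊆ uniformlyEscapingSet f :=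
  isPreconnected_connectedComponentIn.subset_of_closure_inter_subset
    (isOpen_uniformlyEscapingSet f)
    ⟨z, mem_connectedComponentIn (uniformlyEscapingSet_subset_fatouSet hf.continuous hz), hz⟩
    ((Set.inter_subset_inter_right _ (connectedComponentIn_subset _ _)).trans
      (closure_uniformlyEscapingSet_inter_fatouSet_subset hf))

/-! ### The Baker domain of Fatou's function -/

/-- Fatou's function `z ↦ z + 1 + e^{-z}`. -/
noncomputable def fatouFunction (z : ℂ) : ℂ := z + 1 + Complex.exp (-z)

theorem differentiable_fatouFunction : Differentiable ℂ fatouFunction := by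
  unfold fatouFunction
  fun_prop

theorem fiberMap_skewProduct (g h : ℂ → ℂ) : fiberMap (skewProduct g h) = fatouFunction := by
  funext z
  simp [fiberMap, skewProduct, fatouFunction]

theorem le_re_fatouFunction (z : ℂ) : z.re + (1 - Real.exp (-z.re)) ≤ (fatouFunction z).re := by
  have h := (abs_le.1 (Complex.abs_re_le_norm (Complex.exp (-z)))).1
  rw [Complex.norm_exp, Complex.neg_re] at h
  simp only [fatouFunction, Complex.add_re, Complex.one_re]
  linarith

/-- On `Re z ≥ a > 0` each application of Fatou's function moves points to the right by at least
`1 - e^{-a}`. -/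
theorem le_re_iterate_fatouFunction {a : ℝ} (ha : 0 < a) {z : ℂ} (hz : a ≤ z.re) (n : ℕ) :
    a + n * (1 - Real.exp (-a)) ≤ (fatouFunction^[n] z).re := by
  have hea : 0 ≤ 1 - Real.exp (-a) := by
    rw [sub_nonneg, Real.exp_le_one_iff]
    linarith
  induction n with
  | zero => simpa using hz
  | succ n ih =>
    rw [Function.iterate_succ_apply']
    refine le_trans ?_ (le_re_fatouFunction _)
    have h1 : a ≤ (fatouFunction^[n] z).re := by nlinarith [n.cast_nonneg (α := ℝ)]
    have h2 : Real.exp (-(fatouFunction^[n] z).re) ≤ Real.exp (-a) :=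
      Real.exp_le_exp.2 (by linarith)
    push_cast
    linarith

theorem rightHalfPlane_subset_uniformlyEscapingSet :
    {z : ℂ | 0 < z.re} ⊆ uniformlyEscapingSet fatouFunction := by
  intro z (hz : 0 < z.re)
  have ha : 0 < z.re / 2 := half_pos hz
  refine ⟨{y | z.re / 2 < y.re}, isOpen_lt continuous_const Complex.continuous_re,
    show z.re / 2 < z.re from half_lt_self hz, fun R => ?_⟩
  have hpos : 0 < 1 - Real.exp (-(z.re / 2)) := by
    rw [sub_pos, Real.exp_lt_one_iff]
    linarith
  filter_upwards [(tendsto_natCast_atTop_atTop.atTop_mul_const hpos).eventually_gt_atTop R]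
    with n hn y hy
  have h1 := le_re_iterate_fatouFunction ha (le_of_lt hy) n
  have h2 := Complex.re_le_norm (fatouFunction^[n] y)
  linarith

theorem isOpenMap_fatouFunction : IsOpenMap fatouFunction := by
  have han : AnalyticOnNhd ℂ fatouFunction Set.univ :=
    (differentiable_fatouFunction.differentiableOn).analyticOnNhd isOpen_univ
  rcases han.is_constant_or_isOpen isPreconnected_univ with ⟨c, hc⟩ | h
  · exfalso
    have h1 := hc 0 trivial
    rw [← hc (2 * Real.pi * Complex.I) trivial] at h1
    simp only [fatouFunction, neg_zero, Complex.exp_zero, Complex.exp_neg,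
      Complex.exp_two_pi_mul_I, inv_one] at h1
    have h2 : (2 * Real.pi * Complex.I : ℂ) = 0 := by linear_combination -h1
    exact Complex.two_pi_I_ne_zero h2
  · exact fun s hs => h s (Set.subset_univ _) hs

/-- A function of exponential size along a real sequence tending to `+∞` is not a polynomial. -/
theorem not_polynomial_of_exp_le {h : ℂ → ℂ} {x : ℕ → ℝ} (hx : Tendsto x atTop atTop)
    (hexp : ∀ n, Real.exp (x n) ≤ ‖h (x n)‖) : ¬ ∃ P : Polynomial ℂ, ∀ z, h z = P.eval z := by
  rintro ⟨P, hP⟩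
  let Q : Polynomial ℝ :=
    ∑ i ∈ Finset.range (P.natDegree + 1), Polynomial.C ‖P.coeff i‖ * Polynomial.X ^ i
  have hQ : ∀ n, 0 ≤ x n → ‖h (x n)‖ ≤ Q.eval (x n) := by
    intro n hn
    rw [hP, Polynomial.eval_eq_sum_range, Polynomial.eval_finsetSum]
    refine (norm_sum_le _ _).trans_eq (Finset.sum_congr rfl fun i _ => ?_)
    simp [abs_of_nonneg hn]
  have h1 := (Polynomial.tendsto_div_exp_atTop Q).comp hx
  obtain ⟨n, hn, hn0⟩ := ((h1.eventually_lt_const one_pos).and (hx.eventually_ge_atTop 0)).exists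
  rw [Function.comp_apply, div_lt_one (Real.exp_pos _)] at hn
  exact absurd ((hexp n).trans (hQ n hn0)) (not_le.2 hn)

theorem isTranscendentalEntire_fatouFunction : IsTranscendentalEntire fatouFunction := by
  refine ⟨differentiable_fatouFunction, ?_⟩
  rintro ⟨P, hP⟩
  -- Otherwise `e^z`, too, would be a polynomial.
  refine not_polynomial_of_exp_le (h := Complex.exp) (x := fun n => n) tendsto_natCast_atTop_atTop
    (fun n => by simp [Complex.norm_exp]) ⟨(P - Polynomial.X - 1).comp (-Polynomial.X), fun z => ?_⟩
  have := hP (-z)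
  simp only [fatouFunction, neg_neg] at this
  simp only [Polynomial.eval_comp, Polynomial.eval_sub, Polynomial.eval_neg, Polynomial.eval_X,
    Polynomial.eval_one, ← this]
  ring

/-- The component of the Fatou set of Fatou's function that contains the right half plane. -/
noncomputable def fatouBakerDomain : Set ℂ := connectedComponentIn (fatouSet fatouFunction) 2

theorem two_mem_uniformlyEscapingSet : (2 : ℂ) ∈ uniformlyEscapingSet fatouFunction :=
  rightHalfPlane_subset_uniformlyEscapingSet (by simp)

theorem fatouBakerDomain_subset : fatouBakerDomain ⊆ uniformlyEscapingSet fatouFunction :=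
  connectedComponentIn_fatouSet_subset differentiable_fatouFunction two_mem_uniformlyEscapingSet

theorem uniformlyEscapingSet_fatouFunction_subset :
    uniformlyEscapingSet fatouFunction ⊆ fatouSet fatouFunction :=
  uniformlyEscapingSet_subset_fatouSet differentiable_fatouFunction.continuous

theorem rightHalfPlane_subset_fatouBakerDomain : {z : ℂ | 0 < z.re} ⊆ fatouBakerDomain :=
  (convex_halfSpace_re_gt 0).isPreconnected.subset_connectedComponentIn (by simp)
    (rightHalfPlane_subset_uniformlyEscapingSet.trans uniformlyEscapingSet_fatouFunction_subset)

theorem mapsTo_fatouBakerDomain : Set.MapsTo fatouFunction fatouBakerDomain fatouBakerDomain := by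
  have h2 : (2 : ℂ) ∈ fatouBakerDomain := rightHalfPlane_subset_fatouBakerDomain (by simp)
  have hf2 : fatouFunction 2 ∈ fatouBakerDomain := by
    refine rightHalfPlane_subset_fatouBakerDomain ?_
    have h := le_re_iterate_fatouFunction (a := 2) two_pos (z := 2) (by simp) 1
    have : Real.exp (-2) < 1 := Real.exp_lt_one_iff.2 (by norm_num)
    simp only [Function.iterate_one, Nat.cast_one] at h
    show 0 < (fatouFunction 2).re
    linarith
  rw [Set.mapsTo_iff_image_subset]
  have heq : connectedComponentIn (fatouSet fatouFunction) (fatouFunction 2) = fatouBakerDomain :=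
    (connectedComponentIn_eq hf2).symm
  nth_rewrite 2 [← heq]
  refine (isPreconnected_connectedComponentIn.image _
    differentiable_fatouFunction.continuous.continuousOn).subset_connectedComponentIn
    (Set.mem_image_of_mem _ h2) ?_
  rintro _ ⟨y, hy, rfl⟩
  exact uniformlyEscapingSet_fatouFunction_subset
    (mapsTo_uniformlyEscapingSet isOpenMap_fatouFunction (fatouBakerDomain_subset hy))

theorem isBakerDomain_fatouBakerDomain : IsBakerDomain fatouFunction fatouBakerDomain where
  transcendental := isTranscendentalEntire_fatouFunction
  component :=
    ⟨2, uniformlyEscapingSet_fatouFunction_subset two_mem_uniformlyEscapingSet, rfl⟩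
  periodic := ⟨1, one_pos, mapsTo_fatouBakerDomain⟩
  escaping _ hz := tendsto_cobounded_of_mem_uniformlyEscapingSet (fatouBakerDomain_subset hz)

/-! ### A criterion for non-normality in the projective plane -/

theorem CP2.mk_mem_image_setOf_lt_iff (c : ℝ) (i j : Fin 3) (v : {v : Fin 3 → ℂ // v ≠ 0}) :
    CP2.mk v ∈ CP2.mk '' {v | c * ‖v.1 j‖ < ‖v.1 i‖} ↔ c * ‖v.1 j‖ < ‖v.1 i‖ := by
  refine ⟨?_, fun h => ⟨v, h, rfl⟩⟩
  rintro ⟨u, hu, huv⟩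
  obtain ⟨a, ha⟩ := (Projectivization.mk_eq_mk_iff' ℂ u.1 v.1 u.2 v.2).1 huv
  have ha0 : a ≠ 0 := by
    rintro rfl
    exact u.2 (by rw [← ha, zero_smul])
  have hu' : c * ‖u.1 j‖ < ‖u.1 i‖ := hu
  simp only [← ha, Pi.smul_apply, smul_eq_mul, norm_mul] at hu'
  have : 0 < ‖a‖ := norm_pos_iff.2 ha0
  nlinarith

/-- The condition `c |v_j| < |v_i|` on homogeneous coordinates defines an open subset of the
projective plane. -/
theorem CP2.isOpen_setOf_lt (c : ℝ) (i j : Fin 3) :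
    IsOpen (CP2.mk '' {v | c * ‖v.1 j‖ < ‖v.1 i‖}) := by
  refine isOpen_coinduced.2 ?_
  have h : CP2.mk ⁻¹' (CP2.mk '' {v | c * ‖v.1 j‖ < ‖v.1 i‖}) = {v | c * ‖v.1 j‖ < ‖v.1 i‖} :=
    Set.ext fun v => CP2.mk_mem_image_setOf_lt_iff c i j v
  rw [h]
  have hcont : ∀ l : Fin 3, Continuous fun v : {v : Fin 3 → ℂ // v ≠ 0} => ‖v.1 l‖ := fun l =>
    ((continuous_apply l).comp continuous_subtype_val).norm
  exact isOpen_lt ((hcont j).const_mul c) (hcont i)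

theorem toCP2_mem_iff (c : ℝ) (i j : Fin 3) (p : ℂ × ℂ) :
    toCP2 p ∈ CP2.mk '' {v | c * ‖v.1 j‖ < ‖v.1 i‖} ↔
      c * ‖(![p.1, p.2, 1] : Fin 3 → ℂ) j‖ < ‖(![p.1, p.2, 1] : Fin 3 → ℂ) i‖ :=
  CP2.mk_mem_image_setOf_lt_iff c i j _

/-- If the iterates at `p` leave every bounded set horizontally while points `u n → p` return to
`|z| ≤ R` at time `n + 1`, then the iterates are not normal at `p`: a limit function would have to
take at `p` both the value `[1 : 0 : 0]` and a value with `|v₀| ≤ R |v₂|`. -/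
theorem notMem_fatouSet₂_of_tendsto {F : ℂ × ℂ → ℂ × ℂ} {p : ℂ × ℂ} {u : ℕ → ℂ × ℂ} {R M : ℝ}
    (hu : Tendsto u atTop (𝓝 p)) (hR : ∀ n, ‖(F^[n + 1] (u n)).1‖ ≤ R)
    (hesc : Tendsto (fun n => ‖(F^[n] p).1‖) atTop atTop) (hM : ∀ n, ‖(F^[n] p).2‖ ≤ M) :
    p ∉ fatouSet₂ F := by
  rintro ⟨U, hU, hpU, hnorm⟩
  obtain ⟨s, hs, Φ, G, hΦ, -, hlim⟩ := hnorm (fun n x => toCP2 (F^[n + 1] x)) fun n => ⟨n + 1, rfl⟩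
  have : LocallyCompactSpace U := hU.locallyCompactSpace
  have hus : ∀ᶠ k in atTop, u (s k) ∈ U :=
    (hu.comp hs.tendsto_atTop).eventually (hU.mem_nhds hpU)
  -- Compact-open convergence is continuous convergence, so both sequences of values approach `G p`.
  have hmem : ∀ W : Set CP2, IsOpen W → G ⟨p, hpU⟩ ∈ W →
      ∀ᶠ k in atTop, toCP2 (F^[s k + 1] p) ∈ W ∧ toCP2 (F^[s k + 1] (u (s k))) ∈ W := by
    intro W hW hGW
    have h1 : ∀ᶠ q : C(U, CP2) × U in 𝓝 (G, ⟨p, hpU⟩), q.1 q.2 ∈ W :=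
      (ContinuousEval.continuous_eval (F := C(U, CP2))).continuousAt.eventually (hW.mem_nhds hGW)
    rw [nhds_prod_eq] at h1
    obtain ⟨A, hA, D, hD, h2⟩ := eventually_prod_iff.1 h1
    have hD' : ∀ᶠ x in 𝓝 p, ∀ hx : x ∈ U, D ⟨x, hx⟩ := by
      rw [nhds_subtype_eq_comap, eventually_comap] at hD
      filter_upwards [hD] with x hx hxU using hx ⟨x, hxU⟩ rfl
    filter_upwards [hlim.eventually hA, (hu.comp hs.tendsto_atTop).eventually hD', hus]
      with k hk1 hk2 hk3
    have e1 := h2 hk1 hD.self_of_nhds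
    have e2 := h2 hk1 (hk2 hk3)
    rw [hΦ] at e1 e2
    exact ⟨e1, e2⟩
  obtain ⟨v, hv⟩ : ∃ v, CP2.mk v = G ⟨p, hpU⟩ :=
    ⟨⟨(G ⟨p, hpU⟩).rep, Projectivization.rep_nonzero _⟩, Projectivization.mk_rep _⟩
  -- The three cases for `G p = [v]`: `|v₀| > R |v₂|` contradicts the returns, `v₀ = v₂ = 0` the
  -- bound on the second coordinate, and `v₂ ≠ 0`, `|v₀| ≤ R |v₂|` the escape of `p`.
  rcases lt_or_ge (R * ‖v.1 2‖) ‖v.1 0‖ with h | h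
  · obtain ⟨k, -, hk⟩ := (hmem _ (CP2.isOpen_setOf_lt R 0 2) (hv ▸ ⟨v, h, rfl⟩)).exists
    rw [toCP2_mem_iff] at hk
    simp at hk
    exact absurd (hR (s k)) (not_le.2 hk)
  by_cases h2 : v.1 2 = 0
  · have h0 : v.1 0 = 0 := by simpa [h2] using h
    have h1 : v.1 1 ≠ 0 := by
      intro h1
      refine v.2 (funext fun i => ?_)
      fin_cases i <;> assumption
    obtain ⟨k, hk, -⟩ := (hmem _ (CP2.isOpen_setOf_lt M 1 2)
      (hv ▸ ⟨v, by simpa [h2] using h1, rfl⟩)).exists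
    rw [toCP2_mem_iff] at hk
    simp at hk
    exact absurd (hM (s k + 1)) (not_le.2 hk)
  · have hpos : 0 < ‖v.1 2‖ := norm_pos_iff.2 h2
    have hc : (|R| + 1)⁻¹ * ‖v.1 0‖ < ‖v.1 2‖ := by
      rw [inv_mul_lt_iff₀ (by positivity)]
      nlinarith [le_abs_self R]
    have hev := hmem _ (CP2.isOpen_setOf_lt (|R| + 1)⁻¹ 2 0) (hv ▸ ⟨v, hc, rfl⟩)
    have hes := ((tendsto_add_atTop_iff_nat 1).2 hesc).comp hs.tendsto_atTop
    obtain ⟨k, ⟨hk, -⟩, hk2⟩ := (hev.and (hes.eventually_ge_atTop (|R| + 1))).exists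
    rw [toCP2_mem_iff, inv_mul_lt_iff₀ (by positivity)] at hk
    simp at hk hk2
    linarith

/-! ### Orbits of the skew product -/

/-- The orbit of `2` under Fatou's function, as a sequence of real numbers. -/
noncomputable def realOrbit (n : ℕ) : ℝ := (fun t : ℝ => t + 1 + Real.exp (-t))^[n] 2

theorem realOrbit_succ (n : ℕ) :
    realOrbit (n + 1) = realOrbit n + 1 + Real.exp (-realOrbit n) :=
  Function.iterate_succ_apply' _ _ _

theorem realOrbit_add_one_le (n : ℕ) : realOrbit n + 1 ≤ realOrbit (n + 1) := by
  rw [realOrbit_succ]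
  linarith [Real.exp_pos (-realOrbit n)]

theorem strictMono_realOrbit : StrictMono realOrbit :=
  strictMono_nat_of_lt_succ fun n => by linarith [realOrbit_add_one_le n]

theorem add_two_le_realOrbit (n : ℕ) : (n : ℝ) + 2 ≤ realOrbit n := by
  induction n with
  | zero => simp [realOrbit]
  | succ n ih =>
    push_cast
    linarith [realOrbit_add_one_le n]

theorem tendsto_realOrbit : Tendsto realOrbit atTop atTop :=
  tendsto_atTop_mono (fun n => by linarith [add_two_le_realOrbit n])
    (tendsto_natCast_atTop_atTop (R := ℝ))

theorem realOrbit_add_one_le_of_lt {k n : ℕ} (h : k < n) : realOrbit k + 1 ≤ realOrbit n :=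
  (realOrbit_add_one_le k).trans (strictMono_realOrbit.monotone h)

theorem fatouFunction_realOrbit (n : ℕ) : fatouFunction (realOrbit n) = realOrbit (n + 1) := by
  rw [realOrbit_succ, fatouFunction]
  push_cast
  rfl

theorem norm_fatouFunction_sub_le {a b : ℂ} (ha : 0 ≤ a.re) (hb : 0 ≤ b.re) :
    ‖fatouFunction a - fatouFunction b‖ ≤ 2 * ‖a - b‖ := by
  refine (convex_halfSpace_re_ge 0).norm_image_sub_le_of_norm_hasDerivWithin_le
    (f := fatouFunction) (f' := fun z => 1 - Complex.exp (-z)) (s := {z : ℂ | 0 ≤ z.re})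
    (fun z _ => ?_) (fun z hz => ?_) hb ha
  · have h := ((hasDerivAt_id z).add_const 1).add (hasDerivAt_neg z).cexp
    rw [mul_neg_one, ← sub_eq_add_neg] at h
    exact h.hasDerivWithinAt
  · refine (norm_sub_le _ _).trans ?_
    rw [norm_one, Complex.norm_exp, Complex.neg_re]
    have hz' : 0 ≤ z.re := hz
    have := Real.exp_le_one_iff.2 (neg_nonpos.2 hz')
    linarith

theorem snd_iterate_skewProduct (g h : ℂ → ℂ) (p : ℂ × ℂ) (n : ℕ) :
    ((skewProduct g h)^[n] p).2 = g^[n] p.2 := by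
  induction n with
  | zero => rfl
  | succ n ih =>
    rw [Function.iterate_succ_apply', Function.iterate_succ_apply', ← ih]
    rfl

theorem fst_iterate_succ_skewProduct (g h : ℂ → ℂ) (p : ℂ × ℂ) (n : ℕ) :
    ((skewProduct g h)^[n + 1] p).1 = fatouFunction ((skewProduct g h)^[n] p).1 +
      g^[n] p.2 * h ((skewProduct g h)^[n] p).1 := by
  rw [Function.iterate_succ_apply', ← snd_iterate_skewProduct g h p n]
  rfl

theorem fst_iterate_skewProduct_zero {g : ℂ → ℂ} (hg : g 0 = 0) (h : ℂ → ℂ) (n : ℕ) :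
    ((skewProduct g h)^[n] (2, 0)).1 = realOrbit n := by
  induction n with
  | zero => simp [realOrbit]
  | succ n ih =>
    rw [fst_iterate_succ_skewProduct, ih, fatouFunction_realOrbit, Function.iterate_fixed hg]
    simp

theorem differentiable_fst_iterate_skewProduct {g h : ℂ → ℂ} (hg : Differentiable ℂ g)
    (hh : Differentiable ℂ h) (z : ℂ) (n : ℕ) :
    Differentiable ℂ fun w => ((skewProduct g h)^[n] (z, w)).1 := by
  have hF : Differentiable ℂ (skewProduct g h) := by
    unfold skewProduct
    fun_prop
  exact differentiable_fst.comp ((hF.iterate n).comp (by fun_prop))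

/-! ### Construction of the perturbation -/

/-- An entire function that is smaller at the centre of a disc than on its boundary has a zero in the
disc, by the maximum principle for its reciprocal. -/
theorem exists_zero_of_norm_lt_norm_sphere {P : ℂ → ℂ} (hP : Differentiable ℂ P) {ε : ℝ}
    (hε : 0 < ε) {c : ℝ} (h0 : ‖P 0‖ < c) (hc : ∀ w ∈ Metric.sphere (0 : ℂ) ε, c ≤ ‖P w‖) :
    ∃ w, ‖w‖ ≤ ε ∧ P w = 0 := by
  by_contra! hne
  have hcpos : 0 < c := (norm_nonneg _).trans_lt h0
  have hne' : ∀ w ∈ Metric.closedBall (0 : ℂ) ε, P w ≠ 0 := fun w hw =>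
    hne w (by simpa using hw)
  have hd : DiffContOnCl ℂ (fun w => (P w)⁻¹) (Metric.ball 0 ε) :=
    DifferentiableOn.diffContOnCl (by
      rw [closure_ball _ hε.ne']
      exact hP.differentiableOn.inv hne')
  have hle := Complex.norm_le_of_forall_mem_frontier_norm_le Metric.isBounded_ball hd (C := c⁻¹)
    (fun w hw => by
      rw [frontier_ball _ hε.ne'] at hw
      rw [norm_inv]
      exact inv_anti₀ hcpos (hc w hw)) (subset_closure (Metric.mem_ball_self hε))
  rw [norm_inv] at hle
  have hpos : 0 < ‖P 0‖ := norm_pos_iff.2 (hne' 0 (by simp [hε.le]))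
  exact absurd ((inv_le_inv₀ hpos hcpos).1 hle) (not_le.2 h0)

/-- Near an attracting fixed point at `0`, the iterates of `g` do not increase the modulus, and they
vanish only at `0`, because the zeros of `g` are isolated. -/
theorem exists_forall_norm_iterate_le {g : ℂ → ℂ} (hg : Differentiable ℂ g)
    (hg_nonconst : ¬ ∃ c, ∀ w, g w = c) (hg_fixed : g 0 = 0) (hg_attr : ‖deriv g 0‖ < 1) :
    ∃ δ > 0, ∀ w, ‖w‖ < δ → ∀ n : ℕ, ‖g^[n] w‖ ≤ ‖w‖ ∧ (w ≠ 0 → g^[n] w ≠ 0) := by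
  have h1 : ∀ᶠ w in 𝓝 (0 : ℂ), ‖g w‖ ≤ ‖w‖ := by
    have hd := (hg 0).hasDerivAt.isLittleO.bound (sub_pos.2 hg_attr)
    filter_upwards [hd] with w hw
    simp only [hg_fixed, sub_zero, smul_eq_mul] at hw
    calc ‖g w‖ = ‖(g w - w * deriv g 0) + w * deriv g 0‖ := by rw [sub_add_cancel]
      _ ≤ (1 - ‖deriv g 0‖) * ‖w‖ + ‖w‖ * ‖deriv g 0‖ :=
        (norm_add_le _ _).trans (add_le_add hw (norm_mul _ _).le)
      _ = ‖w‖ := by ring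
  have h2 : ∀ᶠ w in 𝓝 (0 : ℂ), w ≠ 0 → g w ≠ 0 := by
    have han : AnalyticOnNhd ℂ g Set.univ := hg.differentiableOn.analyticOnNhd isOpen_univ
    rcases (han 0 trivial).eventually_eq_zero_or_eventually_ne_zero with h | h
    · refine absurd ⟨0, fun w => ?_⟩ hg_nonconst
      exact han.eqOn_zero_of_preconnected_of_eventuallyEq_zero isPreconnected_univ trivial h trivial
    · exact eventually_nhdsWithin_iff.1 h
  obtain ⟨δ, hδ, h⟩ := Metric.eventually_nhds_iff.1 (h1.and h2)
  refine ⟨δ, hδ, fun w hw n => ?_⟩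
  induction n with
  | zero => exact ⟨le_rfl, id⟩
  | succ n ih =>
    have hn := h (y := g^[n] w) (by rw [dist_zero_right]; exact ih.1.trans_lt hw)
    rw [Function.iterate_succ_apply']
    exact ⟨hn.1.trans ih.1, fun hw0 => hn.2 (ih.2 hw0)⟩

/-- The orbit of `(2, w)` follows that of `(2, 0)` for `n` steps if `w` is small compared with a bound
for `h` on the disc `|z| ≤ realOrbit n - 3 / 4`, which contains the points of the orbit before
time `n`. In each step the distance is at most doubled, plus `‖w‖ * K`. -/
theorem norm_fst_iterate_skewProduct_sub_le {g h : ℂ → ℂ} {w : ℂ} {K : ℝ} {n : ℕ}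
    (hw : ∀ k : ℕ, ‖g^[k] w‖ ≤ ‖w‖)
    (hK : ∀ z : ℂ, ‖z‖ ≤ realOrbit n - 3 / 4 → ‖h z‖ ≤ K) (hsmall : 2 ^ n * (‖w‖ * K) ≤ 1 / 4)
    (hK0 : 0 ≤ K) {k : ℕ} (hk : k ≤ n) :
    ‖((skewProduct g h)^[k] (2, w)).1 - realOrbit k‖ ≤ 1 / 4 := by
  have hwK : 0 ≤ ‖w‖ * K := by positivity
  suffices H : ∀ k ≤ n, ‖((skewProduct g h)^[k] (2, w)).1 - realOrbit k‖ ≤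
      (2 ^ k - 1) * (‖w‖ * K) by
    refine (H k hk).trans (le_trans ?_ hsmall)
    have : (2 : ℝ) ^ k ≤ 2 ^ n := pow_le_pow_right₀ one_le_two hk
    nlinarith
  intro k
  induction k with
  | zero => intro; simp [realOrbit]
  | succ k ih =>
    intro hkn
    have hkn' : k < n := hkn
    have ih' := ih hkn'.le
    have hx := add_two_le_realOrbit k
    have hk0 : (0 : ℝ) ≤ k := k.cast_nonneg
    set z := ((skewProduct g h)^[k] (2, w)).1 with hz
    have hquarter : ‖z - realOrbit k‖ ≤ 1 / 4 := by
      refine ih'.trans (le_trans ?_ hsmall)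
      have : (2 : ℝ) ^ k ≤ 2 ^ n := pow_le_pow_right₀ one_le_two hkn'.le
      nlinarith
    have hznorm : ‖z‖ ≤ realOrbit n - 3 / 4 := by
      have h1 := norm_le_norm_add_norm_sub' z (realOrbit k : ℂ)
      rw [Complex.norm_real, Real.norm_of_nonneg (by linarith)] at h1
      linarith [realOrbit_add_one_le_of_lt hkn']
    have hzre : 0 ≤ z.re := by
      have h1 := (abs_le.1 (Complex.abs_re_le_norm (z - realOrbit k))).1
      rw [Complex.sub_re, Complex.ofReal_re] at h1
      linarith
    have hf := norm_fatouFunction_sub_le hzre (b := realOrbit k)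
      (by rw [Complex.ofReal_re]; linarith)
    rw [fatouFunction_realOrbit] at hf
    have hgh : ‖g^[k] w * h z‖ ≤ ‖w‖ * K := by
      rw [norm_mul]
      exact mul_le_mul (hw k) (hK z hznorm) (norm_nonneg _) (norm_nonneg _)
    rw [fst_iterate_succ_skewProduct, ← hz]
    have h3 := norm_add_le (fatouFunction z - realOrbit (k + 1)) (g^[k] w * h z)
    rw [show fatouFunction z + g^[k] w * h z - (realOrbit (k + 1) : ℂ) =
      fatouFunction z - realOrbit (k + 1) + g^[k] w * h z by ring]
    rw [pow_succ]
    linarith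

/-- The inductive step of the construction of `h`. Given the partial sum `p`, there is a summand `q`,
small on `|z| ≤ realOrbit n - 3 / 4`, such that some orbit starting close to `(2, 0)` returns to
`z = 0` at time `n + 1`, for *every* `h` that is close to `p` on this disc and to `p + q` on
`|z| ≤ realOrbit n + 1 / 4`. The summand is `(z / ρ) ^ N` with `ρ` between the moduli of the points
where it has to be small and of those near `realOrbit n`, where it has to be large, and large `N`.
The radius `ε` of the circle of initial values `w` depends on `p` only, so that `N` may be chosen
after it. The bound by the exponential makes `h` transcendental. -/
theorem exists_next_summand {g : ℂ → ℂ} (hg : Differentiable ℂ g)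
    (hg_nonconst : ¬ ∃ c, ∀ w, g w = c) (hg_fixed : g 0 = 0) (hg_attr : ‖deriv g 0‖ < 1)
    (n : ℕ) (p : Polynomial ℂ) :
    ∃ q : Polynomial ℂ, (∀ z : ℂ, ‖z‖ ≤ realOrbit n - 3 / 4 → ‖q.eval z‖ ≤ (1 / 2) ^ (n + 1)) ∧
      ∀ h : ℂ → ℂ, Differentiable ℂ h →
        (∀ z : ℂ, ‖z‖ ≤ realOrbit n - 3 / 4 → ‖h z - p.eval z‖ ≤ 1) →
        (∀ z : ℂ, ‖z‖ ≤ realOrbit n + 1 / 4 → ‖h z - (p + q).eval z‖ ≤ 1) →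
        Real.exp (realOrbit n) ≤ ‖h (realOrbit n)‖ ∧
        ∃ w, w ≠ 0 ∧ ‖w‖ ≤ 1 / ((n : ℝ) + 1) ∧ ((skewProduct g h)^[n + 1] (2, w)).1 = 0 := by
  obtain ⟨δ, hδ, hgδ⟩ := exists_forall_norm_iterate_le hg hg_nonconst hg_fixed hg_attr
  obtain ⟨C, hC⟩ := (isCompact_closedBall (0 : ℂ) (realOrbit n + 1 / 4)).exists_bound_of_continuousOn
    p.continuous.continuousOn
  have hxn := add_two_le_realOrbit n
  have hn0 : (0 : ℝ) ≤ n := n.cast_nonneg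
  replace hC : ∀ z : ℂ, ‖z‖ ≤ realOrbit n + 1 / 4 → ‖p.eval z‖ ≤ C := fun z hz =>
    hC z (by simpa using hz)
  have hC0 : 0 ≤ C := (norm_nonneg _).trans (hC 0 (by rw [norm_zero]; linarith))
  -- `ε` is so small that orbits starting in `{2} × {|w| ≤ ε}` follow that of `(2, 0)` for `n` steps.
  obtain ⟨ε, hε, hεδ, hεn, hεC⟩ : ∃ ε > 0, ε < δ ∧ ε ≤ 1 / ((n : ℝ) + 1) ∧
      2 ^ n * (ε * (C + 1)) ≤ 1 / 4 := by
    refine ⟨min (δ / 2) (min (1 / ((n : ℝ) + 1)) (1 / 4 / (2 ^ n * (C + 1)))), by positivity,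
      (min_le_left _ _).trans_lt (half_lt_self hδ),
      (min_le_right _ _).trans (min_le_left _ _), ?_⟩
    have h1 : min (δ / 2) (min (1 / ((n : ℝ) + 1)) (1 / 4 / (2 ^ n * (C + 1)))) ≤
      1 / 4 / (2 ^ n * (C + 1)) := (min_le_right _ _).trans (min_le_right _ _)
    rw [le_div_iff₀ (by positivity)] at h1
    linarith
  obtain ⟨w₀, hw₀, hmin⟩ := (isCompact_sphere (0 : ℂ) ε).exists_isMinOn
    (NormedSpace.sphere_nonempty.2 hε.le) (f := fun w => ‖g^[n] w‖)
    ((hg.continuous.iterate n).norm.continuousOn)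
  have hμ : 0 < ‖g^[n] w₀‖ := by
    rw [mem_sphere_zero_iff_norm] at hw₀
    exact norm_pos_iff.2 ((hgδ w₀ (hw₀ ▸ hεδ) n).2 (norm_pos_iff.1 (hw₀ ▸ hε)))
  set μ := ‖g^[n] w₀‖
  set ρ := realOrbit n - 1 / 2 with hρ
  have hρ0 : 0 < ρ := by linarith
  -- The lower bound required of the new summand on the disc of radius `1 / 4` around `realOrbit n`.
  set L := C + 1 + Real.exp (realOrbit n) + (2 * realOrbit (n + 1) + 2) / μ with hL
  obtain ⟨N, hN1, hN2⟩ : ∃ N : ℕ, ((realOrbit n - 3 / 4) / ρ) ^ N < (1 / 2) ^ (n + 1) ∧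
      L ≤ ((realOrbit n - 1 / 4) / ρ) ^ N := by
    have h1 := (tendsto_pow_atTop_nhds_zero_of_lt_one
      (div_nonneg (by linarith) hρ0.le : 0 ≤ (realOrbit n - 3 / 4) / ρ)
      ((div_lt_one hρ0).2 (by linarith))).eventually_lt_const
      (by positivity : (0 : ℝ) < (1 / 2) ^ (n + 1))
    have h2 := (tendsto_pow_atTop_atTop_of_one_lt
      ((one_lt_div hρ0).2 (by linarith) : 1 < (realOrbit n - 1 / 4) / ρ)).eventually_ge_atTop L
    exact (h1.and h2).exists
  let q : Polynomial ℂ := (Polynomial.C ((ρ : ℂ)⁻¹) * Polynomial.X) ^ N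
  have hq : ∀ z, ‖q.eval z‖ = (‖z‖ / ρ) ^ N := by
    intro z
    simp only [q, Polynomial.eval_pow, Polynomial.eval_mul, Polynomial.eval_C, Polynomial.eval_X,
      norm_pow, norm_mul, norm_inv, Complex.norm_real, Real.norm_of_nonneg hρ0.le]
    rw [div_eq_inv_mul]
  refine ⟨q, fun z hz => ?_, fun h hh hp hpq => ?_⟩
  · rw [hq]
    refine le_trans ?_ hN1.le
    gcongr
  have hpos : 0 < realOrbit (n + 1) := by linarith [realOrbit_add_one_le n]
  have hlow : ∀ z : ℂ, ‖z - realOrbit n‖ ≤ 1 / 4 →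
      Real.exp (realOrbit n) + (2 * realOrbit (n + 1) + 2) / μ ≤ ‖h z‖ := by
    intro z hz
    have h1 := norm_le_norm_add_norm_sub' z (realOrbit n : ℂ)
    have h2 := norm_le_norm_add_norm_sub z (realOrbit n : ℂ)
    rw [Complex.norm_real, Real.norm_of_nonneg (by linarith)] at h1 h2
    have h3 : L ≤ ‖q.eval z‖ := by
      rw [hq]
      refine hN2.trans ?_
      have : realOrbit n - 1 / 4 ≤ ‖z‖ := by linarith
      have : 0 ≤ realOrbit n - 1 / 4 := by linarith
      gcongr
    have h4 := hpq z (by linarith)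
    have h5 := hC z (by linarith)
    rw [Polynomial.eval_add] at h4
    have h6 := norm_sub_le (h z - (h z - (p.eval z + q.eval z))) (p.eval z)
    have h7 := norm_sub_le (h z) (h z - (p.eval z + q.eval z))
    rw [show h z - (h z - (p.eval z + q.eval z)) - p.eval z = q.eval z by ring] at h6
    linarith
  have hup : ∀ z : ℂ, ‖z‖ ≤ realOrbit n - 3 / 4 → ‖h z‖ ≤ C + 1 := by
    intro z hz
    have h1 := norm_le_norm_add_norm_sub' (h z) (p.eval z)
    linarith [hp z hz, hC z (by linarith)]
  refine ⟨?_, ?_⟩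
  · have h1 := hlow (realOrbit n) (by simp)
    have : 0 ≤ (2 * realOrbit (n + 1) + 2) / μ := by positivity
    linarith
  -- On the circle `|w| = ε` the perturbation `g^[n] w * h z` outweighs `fatouFunction z`.
  have hsphere : ∀ w ∈ Metric.sphere (0 : ℂ) ε,
      realOrbit (n + 1) + 1 ≤ ‖((skewProduct g h)^[n + 1] (2, w)).1‖ := by
    intro w hw
    have hμw : μ ≤ ‖g^[n] w‖ := hmin hw
    rw [mem_sphere_zero_iff_norm] at hw
    have hz := norm_fst_iterate_skewProduct_sub_le (g := g) (h := h) (w := w)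
      (fun k => (hgδ w (hw ▸ hεδ) k).1) hup (by rwa [hw]) (by positivity) le_rfl
    rw [fst_iterate_succ_skewProduct]
    set z := ((skewProduct g h)^[n] (2, w)).1
    have hzre : 0 ≤ z.re := by
      have h1 := (abs_le.1 (Complex.abs_re_le_norm (z - realOrbit n))).1
      rw [Complex.sub_re, Complex.ofReal_re] at h1
      linarith
    have hf := norm_fatouFunction_sub_le hzre (b := realOrbit n)
      (by rw [Complex.ofReal_re]; linarith)
    rw [fatouFunction_realOrbit] at hf
    have hfz := norm_le_norm_add_norm_sub' (fatouFunction z) (realOrbit (n + 1) : ℂ)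
    rw [Complex.norm_real, Real.norm_of_nonneg hpos.le] at hfz
    have hgh : 2 * realOrbit (n + 1) + 2 ≤ ‖g^[n] w * h z‖ := by
      rw [norm_mul]
      have h1 : (2 * realOrbit (n + 1) + 2) / μ ≤ ‖h z‖ := by
        linarith [hlow z hz, Real.exp_pos (realOrbit n)]
      calc 2 * realOrbit (n + 1) + 2 = μ * ((2 * realOrbit (n + 1) + 2) / μ) := by
            field_simp
        _ ≤ _ := by gcongr
    have h4 := norm_sub_le (fatouFunction z + g^[n] w * h z) (fatouFunction z)
    rw [add_sub_cancel_left] at h4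
    linarith
  obtain ⟨w, hwε, hw⟩ := exists_zero_of_norm_lt_norm_sphere
    (differentiable_fst_iterate_skewProduct hg hh 2 (n + 1)) hε (c := realOrbit (n + 1) + 1)
    (by
      rw [fst_iterate_skewProduct_zero hg_fixed, Complex.norm_real, Real.norm_of_nonneg hpos.le]
      linarith) hsphere
  refine ⟨w, ?_, hwε.trans hεn, hw⟩
  rintro rfl
  rw [fst_iterate_skewProduct_zero hg_fixed] at hw
  exact hpos.ne' (by exact_mod_cast hw)

/-- There is a transcendental entire `h` such that, for each `n`, the orbit of `(2, w)` for some small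
`w ≠ 0` returns to `z = 0` at time `n + 1`. -/
theorem exists_transcendental_forall_exists_zero {g : ℂ → ℂ} (hg : Differentiable ℂ g)
    (hg_nonconst : ¬ ∃ c, ∀ w, g w = c) (hg_fixed : g 0 = 0) (hg_attr : ‖deriv g 0‖ < 1) :
    ∃ h : ℂ → ℂ, IsTranscendentalEntire h ∧ ∀ n : ℕ,
      ∃ w, w ≠ 0 ∧ ‖w‖ ≤ 1 / ((n : ℝ) + 1) ∧ ((skewProduct g h)^[n + 1] (2, w)).1 = 0 := by
  choose q hq hqh using exists_next_summand hg hg_nonconst hg_fixed hg_attr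
  -- `S n` is the sum of the first `n` summands, each of which is chosen in terms of the sum so far.
  let S : ℕ → Polynomial ℂ := fun n => Nat.rec 0 (fun n p => p + q n p) n
  have hS : ∀ n, S (n + 1) = S n + q n (S n) := fun _ => rfl
  have hSsum : ∀ n z, (S n).eval z = ∑ k ∈ Finset.range n, (q k (S k)).eval z := by
    intro n z
    induction n with
    | zero => simp [S]
    | succ n ih => rw [hS, Polynomial.eval_add, ih, Finset.sum_range_succ]
  have hterm : ∀ n (z : ℂ), ‖z‖ ≤ realOrbit n - 3 / 4 → ∀ k,
      ‖(q (k + n) (S (k + n))).eval z‖ ≤ (1 / 2) ^ (k + 1) := by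
    intro n z hz k
    refine (hq (k + n) _ z (hz.trans ?_)).trans
      (pow_le_pow_of_le_one (by norm_num) (by norm_num) (by omega))
    linarith [strictMono_realOrbit.monotone (Nat.le_add_left n k)]
  have hgeom : HasSum (fun k : ℕ => (1 / 2 : ℝ) ^ (k + 1)) 1 := by
    have := hasSum_geometric_two.mul_left (1 / 2)
    simpa [pow_succ'] using this
  have hsummable : ∀ z : ℂ, Summable fun k => (q k (S k)).eval z := by
    intro z
    obtain ⟨n, hn⟩ := (tendsto_realOrbit.eventually_ge_atTop (‖z‖ + 3 / 4)).exists
    exact (summable_nat_add_iff n).1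
      (Summable.of_norm_bounded hgeom.summable (hterm n z (by linarith)))
  let h : ℂ → ℂ := fun z => ∑' k, (q k (S k)).eval z
  have htail : ∀ n z, h z - (S n).eval z = ∑' k, (q (k + n) (S (k + n))).eval z := by
    intro n z
    rw [hSsum, sub_eq_iff_eq_add', (hsummable z).sum_add_tsum_nat_add n]
  have hclose : ∀ n (z : ℂ), ‖z‖ ≤ realOrbit n - 3 / 4 → ‖h z - (S n).eval z‖ ≤ 1 := by
    intro n z hz
    rw [htail]
    exact tsum_of_norm_bounded hgeom (hterm n z hz)
  have hdiff : Differentiable ℂ h := by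
    intro z
    obtain ⟨n, hn⟩ := (tendsto_realOrbit.eventually_ge_atTop (‖z‖ + 2)).exists
    have hball : z ∈ Metric.ball (0 : ℂ) (realOrbit n - 3 / 4) := by
      rw [mem_ball_zero_iff]
      linarith
    have h1 : DifferentiableOn ℂ (fun z => ∑' k, (q (k + n) (S (k + n))).eval z)
        (Metric.ball 0 (realOrbit n - 3 / 4)) :=
      Complex.differentiableOn_tsum_of_summable_norm hgeom.summable
        (fun k => (Polynomial.differentiable _).differentiableOn) Metric.isOpen_ball
        fun k y hy => hterm n y (mem_ball_zero_iff.1 hy).le k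
    have h2 : h = fun z => (S n).eval z + ∑' k, (q (k + n) (S (k + n))).eval z := by
      funext y
      rw [← htail, add_sub_cancel]
    rw [h2]
    exact (S n).differentiableAt.add (h1.differentiableAt (Metric.isOpen_ball.mem_nhds hball))
  have hall := fun n => hqh n (S n) h hdiff (hclose n) fun z hz => by
    rw [← hS]
    exact hclose (n + 1) z (by linarith [realOrbit_add_one_le n])
  exact ⟨h, ⟨hdiff, not_polynomial_of_exp_le tendsto_realOrbit fun n => (hall n).1⟩,
    fun n => (hall n).2⟩

/-! ### The Baker domain does not bulge -/

theorem mainTheorem2 (g : ℂ → ℂ) (hg : Differentiable ℂ g) (hg_nonconst : ¬ ∃ c, ∀ w, g w = c)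
    (hg_fixed : g 0 = 0) (hg_attr : ‖deriv g 0‖ < 1) :
    ∃ h : ℂ → ℂ, IsTranscendentalEntire h ∧
      ∃ B : Set ℂ, IsBakerDomain (fiberMap (skewProduct g h)) B ∧
        {z : ℂ | 0 < z.re} ⊆ B ∧
        Set.MapsTo (fiberMap (skewProduct g h)) B B ∧
        ¬ Bulges (skewProduct g h) B ∧
        ∃ x₀ ∈ B, ∃ w : ℕ → ℂ, (∀ n, w n ≠ 0) ∧ Tendsto w atTop (𝓝 0) ∧
          ∀ n, ‖((skewProduct g h)^[n + 1] (x₀, w n)).1‖ ≤ 3 := by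
  obtain ⟨h, hh, hzero⟩ :=
    exists_transcendental_forall_exists_zero hg hg_nonconst hg_fixed hg_attr
  choose w hw0 hwle hw using hzero
  have hwlim : Tendsto w atTop (𝓝 0) :=
    squeeze_zero_norm hwle tendsto_one_div_add_atTop_nhds_zero_nat
  have hbdd : ∀ n, ‖((skewProduct g h)^[n + 1] (2, w n)).1‖ ≤ 3 := fun n => by
    rw [hw, norm_zero]
    norm_num
  have h2 : (2 : ℂ) ∈ fatouBakerDomain := rightHalfPlane_subset_fatouBakerDomain (by simp)
  refine ⟨h, hh, fatouBakerDomain, ?_⟩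
  rw [fiberMap_skewProduct]
  refine ⟨isBakerDomain_fatouBakerDomain, rightHalfPlane_subset_fatouBakerDomain,
    mapsTo_fatouBakerDomain, ?_, 2, h2, w, hw0, hwlim, hbdd⟩
  rintro ⟨Ω, ⟨p, -, rfl⟩, hΩ⟩
  refine notMem_fatouSet₂_of_tendsto (tendsto_const_nhds.prodMk_nhds hwlim) hbdd ?_ (M := 0) ?_
    (connectedComponentIn_subset _ _ (hΩ 2 h2))
  · simp only [fst_iterate_skewProduct_zero hg_fixed, Complex.norm_real]
    exact tendsto_norm_atTop_atTop.comp tendsto_realOrbit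
  · intro n
    rw [snd_iterate_skewProduct, Function.iterate_fixed hg_fixed, norm_zero]
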